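/- Let $1<p<\infty$ and let $C_\infty$ be the infinite continuous Cesàro operator on the complex Banach space $L^p(0,\infty)$ (with respect to Lebesgue measure), that is, the bounded linear operator $$(C_\infty f)(x)=\frac1x\int_0^x f(t)\,dt\qquad\text{for almost every } x>0 .$$ If $\lambda\in\mathbb C$, $\lambda\neq 1$, and $X$ is a bounded linear operator on $L^p(0,\infty)$ such that $C_\infty X=\lambda XC_\infty$, then $X=0$. Consequently the set of extended eigenvalues of $C_\infty$, that is, the set of all $\lambda\in\mathbb C$ for which there is a nonzero bounded linear operator $X$ on $L^p(0,\infty)$ with $C_\infty X=\lambda XC_\infty$, is exactly $\{1\}$. -/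

import Mathlib

open MeasureTheory Set
open scoped ENNReal

noncomputable section

/-- Lebesgue measure on the half-line `(0, ∞)`. -/
abbrev halfLine : Measure ℝ := volume.restrict (Ioi 0)

/-- The averages `x ↦ (1/x) ∫₀ˣ f(t) dt`. -/
def cesaroAvg (f : ℝ → ℂ) (x : ℝ) : ℂ := (1 / (x : ℂ)) * ∫ t in (0 : ℝ)..x, f t

lemma hardy_pointwise {r q : ℝ} (h : r.HolderConjugate q) {g : ℝ → ℝ≥0∞} (hg : Measurable g)
    {x : ℝ} (hx : 0 < x) :
    (ENNReal.ofReal x⁻¹ * ∫⁻ t in Ioc 0 x, g t) ^ r ≤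
      ENNReal.ofReal (q ^ (r - 1) * x ^ (-1 - 1 / q)) *
        ∫⁻ t in Ioc 0 x, ENNReal.ofReal (t ^ (1 / q)) * g t ^ r := by
  have hr := h.pos
  have hq := h.symm.pos
  have hr1 := h.lt
  have hinv : 1 / q = 1 - 1 / r := by have := h.inv_add_inv_eq_one; simp only [one_div]; linarith
  have hqr : q = r / (r - 1) := h.conjugate_eq
  have hr1' : r - 1 ≠ 0 := by linarith
  have hold := ENNReal.lintegral_mul_le_Lp_mul_Lq (volume.restrict (Ioc 0 x)) h
    (f := fun t => ENNReal.ofReal (t ^ (1 / (r * q))) * g t)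
    (g := fun t => ENNReal.ofReal (t ^ (-1 / (r * q)))) (by fun_prop) (by fun_prop)
  have e1 : ∫⁻ t in Ioc 0 x, ((fun t => ENNReal.ofReal (t ^ (1 / (r * q))) * g t) *
      (fun t => ENNReal.ofReal (t ^ (-1 / (r * q))))) t = ∫⁻ t in Ioc 0 x, g t := by
    refine setLIntegral_congr_fun measurableSet_Ioc fun t ht => ?_
    have ht0 : 0 < t := ht.1
    simp only [Pi.mul_apply]
    rw [mul_right_comm, ← ENNReal.ofReal_mul (by positivity), ← Real.rpow_add ht0]
    simp [neg_div]
  have e2 : ∫⁻ t in Ioc 0 x, (ENNReal.ofReal (t ^ (1 / (r * q))) * g t) ^ r =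
      ∫⁻ t in Ioc 0 x, ENNReal.ofReal (t ^ (1 / q)) * g t ^ r := by
    refine setLIntegral_congr_fun measurableSet_Ioc fun t ht => ?_
    have ht0 : 0 < t := ht.1
    rw [ENNReal.mul_rpow_of_nonneg _ _ hr.le, ENNReal.ofReal_rpow_of_pos (by positivity),
      ← Real.rpow_mul ht0.le]
    have h4 : 1 / (r * q) * r = 1 / q := by field_simp
    rw [h4]
  have e3 : ∫⁻ t in Ioc 0 x, (ENNReal.ofReal (t ^ (-1 / (r * q)))) ^ q =
      ENNReal.ofReal (q * x ^ (1 / q)) := by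
    have hlt : -1 < -1 / r := by
      rw [neg_div, neg_lt_neg_iff, div_lt_one hr]; exact hr1
    have : ∫⁻ t in Ioc 0 x, (ENNReal.ofReal (t ^ (-1 / (r * q)))) ^ q =
        ∫⁻ t in Ioc 0 x, ENNReal.ofReal (t ^ (-1 / r)) := by
      refine setLIntegral_congr_fun measurableSet_Ioc fun t ht => ?_
      have ht0 : 0 < t := ht.1
      rw [ENNReal.ofReal_rpow_of_pos (by positivity), ← Real.rpow_mul ht0.le]
      congr 2
      field_simp
    rw [this, ← ofReal_integral_eq_lintegral_ofReal]
    · rw [← intervalIntegral.integral_of_le hx.le, integral_rpow (Or.inl hlt)]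
      have h1 : -1 / r + 1 = 1 / q := by rw [hinv]; ring
      rw [h1, Real.zero_rpow (by positivity)]
      congr 1
      field_simp
      ring
    · exact (intervalIntegrable_iff_integrableOn_Ioc_of_le hx.le).1
        (intervalIntegral.intervalIntegrable_rpow' hlt)
    · filter_upwards [self_mem_ae_restrict measurableSet_Ioc] with t ht
      exact Real.rpow_nonneg ht.1.le _
  rw [e1, e2, e3] at hold
  set J := ∫⁻ t in Ioc 0 x, ENNReal.ofReal (t ^ (1 / q)) * g t ^ r
  calc (ENNReal.ofReal x⁻¹ * ∫⁻ t in Ioc 0 x, g t) ^ r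
      ≤ (ENNReal.ofReal x⁻¹ * (J ^ (1 / r) * ENNReal.ofReal (q * x ^ (1 / q)) ^ (1 / q))) ^ r := by
        gcongr
    _ = ENNReal.ofReal (q ^ (r - 1) * x ^ (-1 - 1 / q)) * J := by
        rw [ENNReal.mul_rpow_of_nonneg _ _ hr.le, ENNReal.mul_rpow_of_nonneg _ _ hr.le,
          ← ENNReal.rpow_mul, ← ENNReal.rpow_mul, one_div_mul_cancel hr.ne', ENNReal.rpow_one,
          ENNReal.ofReal_rpow_of_pos (by positivity), ENNReal.ofReal_rpow_of_pos (by positivity),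
          mul_comm J, ← mul_assoc, ← ENNReal.ofReal_mul (by positivity)]
        congr 2
        have h2 : 1 / q * r = r - 1 := by rw [hinv]; field_simp
        rw [h2, Real.mul_rpow hq.le (by positivity), ← Real.rpow_mul hx.le,
          Real.inv_rpow hx.le, ← Real.rpow_neg hx.le, mul_left_comm, ← Real.rpow_add hx]
        congr 2
        rw [hinv]
        field_simp
        ring

lemma hardy_lintegral {r q : ℝ} (h : r.HolderConjugate q) {g : ℝ → ℝ≥0∞} (hg : Measurable g) :
    ∫⁻ x in Ioi 0, (ENNReal.ofReal x⁻¹ * ∫⁻ t in Ioc 0 x, g t) ^ r ≤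
      ENNReal.ofReal q ^ r * ∫⁻ t in Ioi 0, g t ^ r := by
  have hr := h.pos
  have hq := h.symm.pos
  have hS : MeasurableSet {z : ℝ × ℝ | z.2 ≤ z.1} := measurableSet_le measurable_snd measurable_fst
  set F : ℝ → ℝ → ℝ≥0∞ := fun x t => ENNReal.ofReal (q ^ (r - 1) * x ^ (-1 - 1 / q)) *
        ({z : ℝ × ℝ | z.2 ≤ z.1}.indicator
          (fun z => ENNReal.ofReal (z.2 ^ (1 / q)) * g z.2 ^ r) (x, t)) with hF
  have hFm : Measurable (Function.uncurry F) := by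
    refine Measurable.mul (by fun_prop) (Measurable.indicator (by fun_prop) hS)
  calc ∫⁻ x in Ioi 0, (ENNReal.ofReal x⁻¹ * ∫⁻ t in Ioc 0 x, g t) ^ r
      ≤ ∫⁻ x in Ioi 0, ENNReal.ofReal (q ^ (r - 1) * x ^ (-1 - 1 / q)) *
        ∫⁻ t in Ioc 0 x, ENNReal.ofReal (t ^ (1 / q)) * g t ^ r :=
        setLIntegral_mono' measurableSet_Ioi fun x hx => hardy_pointwise h hg hx
    _ = ∫⁻ x in Ioi 0, ∫⁻ t in Ioi 0, F x t := by
        refine setLIntegral_congr_fun measurableSet_Ioi fun x hx => ?_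
        simp only [hF]
        rw [lintegral_const_mul' _ _ ENNReal.ofReal_ne_top]
        congr 1
        have : ∀ t, ({z : ℝ × ℝ | z.2 ≤ z.1}.indicator
          (fun z => ENNReal.ofReal (z.2 ^ (1 / q)) * g z.2 ^ r) (x, t)) =
          (Iic x).indicator (fun t => ENNReal.ofReal (t ^ (1 / q)) * g t ^ r) t := by
          intro t; simp [indicator]
        simp only [this]
        rw [setLIntegral_indicator measurableSet_Iic, Iic_inter_Ioi]
    _ = ∫⁻ t in Ioi 0, ∫⁻ x in Ioi 0, F x t := lintegral_lintegral_swap hFm.aemeasurable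
    _ = ∫⁻ t in Ioi 0, ENNReal.ofReal q ^ r * g t ^ r := by
        refine setLIntegral_congr_fun measurableSet_Ioi fun t ht => ?_
        have ht0 : 0 < t := ht
        have : ∀ x, F x t = (Ici t).indicator (fun x => ENNReal.ofReal (x ^ (-1 - 1 / q)) *
            (ENNReal.ofReal (q ^ (r - 1)) * (ENNReal.ofReal (t ^ (1 / q)) * g t ^ r))) x := by
          intro x
          by_cases hx : t ≤ x
          · simp only [hF, indicator, mem_ofPred_eq, hx, if_true, mem_Ici]
            rw [ENNReal.ofReal_mul (by positivity)]
            ring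
          · simp [hF, indicator, hx]
        simp only [this]
        have hsub : Ici t ∩ Ioi 0 = Ici t := inter_eq_left.2 fun y hy => ht0.trans_le hy
        rw [setLIntegral_indicator measurableSet_Ici, hsub, setLIntegral_congr Ioi_ae_eq_Ici.symm,
          lintegral_mul_const _ (by fun_prop)]
        have hlt : -1 - 1 / q < -1 := by have : 0 < 1 / q := by positivity
                                         linarith
        rw [← ofReal_integral_eq_lintegral_ofReal (integrableOn_Ioi_rpow_of_lt hlt ht0) (by
            filter_upwards [self_mem_ae_restrict measurableSet_Ioi] with y hy
            exact Real.rpow_nonneg (ht0.trans hy).le _), integral_Ioi_rpow_of_lt hlt ht0,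
          ← mul_assoc, ← mul_assoc, ← ENNReal.ofReal_mul' (by positivity),
          ← ENNReal.ofReal_mul' (by positivity), ENNReal.ofReal_rpow_of_pos hq]
        congr 2
        have h3 : -1 - 1 / q + 1 = -(1 / q) := by ring
        rw [h3, Real.rpow_neg ht0.le, Real.rpow_sub hq, Real.rpow_one]
        field_simp
    _ = ENNReal.ofReal q ^ r * ∫⁻ t in Ioi 0, g t ^ r :=
        lintegral_const_mul' _ _ (ENNReal.rpow_ne_top_of_nonneg hr.le ENNReal.ofReal_ne_top)

lemma enorm_cesaroAvg_le (f : ℝ → ℂ) {x : ℝ} (hx : 0 < x) :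
    ‖cesaroAvg f x‖ₑ ≤ ENNReal.ofReal x⁻¹ * ∫⁻ t in Ioc 0 x, ‖f t‖ₑ := by
  rw [cesaroAvg, enorm_mul, intervalIntegral.integral_of_le hx.le]
  gcongr
  · rw [← ofReal_norm]
    simp [abs_of_pos hx]
  · exact enorm_integral_le_lintegral_enorm _

lemma aestronglyMeasurable_cesaroAvg {f : ℝ → ℂ} (hf : StronglyMeasurable f) :
    AEStronglyMeasurable (cesaroAvg f) halfLine := by
  have hS : MeasurableSet {z : ℝ × ℝ | 0 < z.2 ∧ z.2 ≤ z.1} :=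
    (measurableSet_lt measurable_const measurable_snd).inter
      (measurableSet_le measurable_snd measurable_fst)
  have hm : StronglyMeasurable fun x : ℝ => (1 / (x : ℂ)) *
      ∫ t, {z : ℝ × ℝ | 0 < z.2 ∧ z.2 ≤ z.1}.indicator (fun z => f z.2) (x, t) := by
    refine StronglyMeasurable.mul (by fun_prop) ?_
    exact StronglyMeasurable.integral_prod_right
      ((hf.comp_measurable measurable_snd).indicator hS)
  refine hm.aestronglyMeasurable.congr ?_
  filter_upwards [self_mem_ae_restrict measurableSet_Ioi] with x hx
  rw [cesaroAvg, intervalIntegral.integral_of_le (le_of_lt hx), ← integral_indicator measurableSet_Ioc]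
  rfl

/-- Hardy's inequality. -/
lemma eLpNorm_cesaroAvg_le {p : ℝ≥0∞} (hp : 1 < p) (hp' : p < ∞) {f : ℝ → ℂ}
    (hf : StronglyMeasurable f) :
    eLpNorm (cesaroAvg f) p halfLine ≤
      ENNReal.ofReal (p.toReal / (p.toReal - 1)) * eLpNorm f p halfLine := by
  have hp0 : p ≠ 0 := (zero_lt_one.trans hp).ne'
  have h1 : 1 < p.toReal := by
    simpa using (ENNReal.toReal_lt_toReal ENNReal.one_ne_top hp'.ne).2 hp
  have hc := Real.HolderConjugate.conjExponent h1
  have hr := hc.pos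
  have key := hardy_lintegral hc hf.measurable.enorm
  rw [Real.conjExponent] at key
  rw [eLpNorm_eq_lintegral_rpow_enorm_toReal hp0 hp'.ne,
    eLpNorm_eq_lintegral_rpow_enorm_toReal hp0 hp'.ne]
  calc _ ≤ (ENNReal.ofReal (p.toReal / (p.toReal - 1)) ^ p.toReal *
        ∫⁻ t in Ioi 0, ‖f t‖ₑ ^ p.toReal) ^ (1 / p.toReal) := by
        gcongr
        refine (setLIntegral_mono' measurableSet_Ioi fun x hx => ?_).trans key
        gcongr
        exact enorm_cesaroAvg_le f hx
    _ = _ := by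
        rw [ENNReal.mul_rpow_of_nonneg _ _ (by positivity), ← ENNReal.rpow_mul,
          mul_one_div_cancel hr.ne', ENNReal.rpow_one]

lemma memLp_cesaroAvg {p : ℝ≥0∞} (hp : 1 < p) (hp' : p < ∞) (f : Lp ℂ p halfLine) :
    MemLp (cesaroAvg f) p halfLine :=
  ⟨aestronglyMeasurable_cesaroAvg (Lp.stronglyMeasurable f),
    (eLpNorm_cesaroAvg_le hp hp' (Lp.stronglyMeasurable f)).trans_lt
      (ENNReal.mul_lt_top ENNReal.ofReal_lt_top (Lp.eLpNorm_lt_top f))⟩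

/-- The average at `x > 0` depends only on the values of `f` almost everywhere on `(0, ∞)`. -/
lemma cesaroAvg_congr {f g : ℝ → ℂ} (h : f =ᵐ[halfLine] g) {x : ℝ} (hx : 0 < x) :
    cesaroAvg f x = cesaroAvg g x := by
  rw [cesaroAvg, cesaroAvg, intervalIntegral.integral_of_le hx.le,
    intervalIntegral.integral_of_le hx.le]
  congr 1
  exact integral_congr_ae (ae_restrict_of_ae_restrict_of_subset Ioc_subset_Ioi_self h)

lemma intervalIntegrable_of_Lp {p : ℝ≥0∞} (hp : 1 ≤ p) (f : Lp ℂ p halfLine)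
    {x : ℝ} (hx : 0 < x) : IntervalIntegrable f volume 0 x := by
  rw [intervalIntegrable_iff_integrableOn_Ioc_of_le hx.le]
  have := (Lp.memLp f).mono_measure (Measure.restrict_mono (Ioc_subset_Ioi_self : Ioc 0 x ⊆ Ioi 0) le_rfl)
  exact this.integrable hp

/-- The infinite continuous Cesàro operator `C_∞` on `L^p(0, ∞)`, `1 < p < ∞`, as a bounded
linear operator: `(C_∞ f)(x) = (1/x) ∫₀ˣ f(t) dt` for almost every `x > 0`. -/
def cesaroInfty (p : ℝ≥0∞) [Fact (1 ≤ p)] (hp : 1 < p) (hp' : p < ∞) :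
    Lp ℂ p halfLine →L[ℂ] Lp ℂ p halfLine :=
  LinearMap.mkContinuous
    { toFun := fun f => (memLp_cesaroAvg hp hp' f).toLp (cesaroAvg f)
      map_add' := fun f g => by
        rw [← MemLp.toLp_add, MemLp.toLp_eq_toLp_iff]
        filter_upwards [self_mem_ae_restrict measurableSet_Ioi] with x hx
        rw [cesaroAvg_congr (Lp.coeFn_add f g) hx]
        simp only [cesaroAvg, Pi.add_apply]
        rw [intervalIntegral.integral_add (intervalIntegrable_of_Lp hp.le f hx)
          (intervalIntegrable_of_Lp hp.le g hx), mul_add]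
      map_smul' := fun c f => by
        rw [RingHom.id_apply, ← MemLp.toLp_const_smul, MemLp.toLp_eq_toLp_iff]
        filter_upwards [self_mem_ae_restrict measurableSet_Ioi] with x hx
        rw [cesaroAvg_congr (Lp.coeFn_smul c f) hx]
        simp only [cesaroAvg, Pi.smul_apply]
        rw [intervalIntegral.integral_smul, mul_smul_comm] }
    (p.toReal / (p.toReal - 1)) (fun f => by
      have h1 : 1 < p.toReal := by
        simpa using (ENNReal.toReal_lt_toReal ENNReal.one_ne_top hp'.ne).2 hp
      have h0 : 0 ≤ p.toReal / (p.toReal - 1) := div_nonneg (by linarith) (by linarith)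
      simp only [LinearMap.coe_mk, AddHom.coe_mk]
      rw [Lp.norm_toLp, Lp.norm_def, ← ENNReal.toReal_ofReal h0, ← ENNReal.toReal_mul]
      exact ENNReal.toReal_mono
        (ENNReal.mul_lt_top ENNReal.ofReal_lt_top (Lp.eLpNorm_lt_top f)).ne
        (eLpNorm_cesaroAvg_le hp hp' (Lp.stronglyMeasurable f)))

lemma cesaroInfty_apply (p : ℝ≥0∞) [Fact (1 ≤ p)] (hp : 1 < p) (hp' : p < ∞)
    (f : Lp ℂ p halfLine) :
    cesaroInfty p hp hp' f =ᵐ[halfLine] fun x => (1 / (x : ℂ)) * ∫ t in (0 : ℝ)..x, f t :=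
  MemLp.coeFn_toLp (memLp_cesaroAvg hp hp' f)

/-- The set of extended eigenvalues of a bounded operator `T` on a complex Banach space: the
scalars `lam` for which there is a nonzero bounded operator `X` with `T X = lam X T`. -/
def extendedEigenvalues {E : Type*} [NormedAddCommGroup E] [NormedSpace ℂ E] (T : E →L[ℂ] E) :
    Set ℂ :=
  {lam : ℂ | ∃ X : E →L[ℂ] E, X ≠ 0 ∧ T ∘L X = lam • (X ∘L T)}

end

/-! ### Operators with a two-sided resolvent bound off a vertical line. -/

section Abstract

variable {E : Type*} [NormedAddCommGroup E] [NormedSpace ℂ E]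

/-! Write `T` for the Cesàro operator, `a = 1 - 1/p` and `S ζ = (1 - ζ T)⁻¹ T`. Three facts about
`T` suffice: it is injective, no nonzero `y` satisfies `y = ζ T y`, and `S ζ` exists with norm at
most `1 / |Re ζ - a|` off the line `Re ζ = a`.

From `T X = lam X T` follows `S ζ X = lam X S (lam ζ)`. Thus `S ζ (X f)`, defined off `Re ζ = a`,
continues through that line wherever `Re (lam ζ) ≠ a`, and the glued function `F` obeys a
reciprocal-distance bound for each of the two loci. As `lam ≠ 1` and `a > 0`, the loci differ. For
real `lam` they are disjoint, so `F` is bounded and entire, hence constant, hence zero by decay.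
Otherwise they cross in one point `ω`, and removability with Liouville makes `(ζ - ω) F ζ` a
constant `P` (`exists_eq_simple_pole`). Clearing the resolvent gives `(1 - ζ T) P = (ζ - ω) T X f`;
two values of `ζ` yield `P = ω T P`, so `P = 0`, then `T X f = 0` and `X f = 0`
(`eq_zero_of_intertwine`).

For the resolvent bound, `T` is the average of the dilations `f (s ·)` with kernel `1_{s ≤ 1}`. Such
averages multiply like convolutions, and `S ζ` has kernel `s^(-ζ) 1_{s ≤ 1}` left of the line and
`-s^(-ζ) 1_{s > 1}` right of it. A dilation has norm `s^(-1/p)`, so Minkowski's inequality bounds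
the norm by the integral of the absolute kernel against `s^(-1/p)`, which is exactly `1 / |Re ζ -
a|`. -/

/-- A function bounded by the reciprocal distances to two distinct lines `Re ζ = a` and
`Re (lam ζ) = a`, and holomorphic off their intersection, has at most one simple pole and
vanishes at infinity. -/
lemma exists_eq_simple_pole [CompleteSpace E] {a : ℝ} (ha : 0 < a) {lam : ℂ} (hlam : lam ≠ 1)
    {F : ℂ → E} {K : ℝ}
    (hd : ∀ ζ : ℂ, ζ.re ≠ a ∨ (lam * ζ).re ≠ a → DifferentiableAt ℂ F ζ)
    (hb₁ : ∀ ζ : ℂ, |ζ.re - a| * ‖F ζ‖ ≤ K)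
    (hb₂ : ∀ ζ : ℂ, |(lam * ζ).re - a| * ‖F ζ‖ ≤ K) :
    ∃ (ω : ℂ) (P : E), ω ≠ 0 ∧ ∀ ζ : ℂ, ζ.re ≠ a → (ζ - ω) • F ζ = P := by
  by_cases hβ : lam.im = 0
  -- Real `lam`: the loci are parallel (the second is empty for `lam = 0`), so no point is close to
  -- both and `F` is bounded.
  · have hα : lam.re ≠ 1 := fun h => hlam (Complex.ext h hβ)
    have hα' : 0 < |lam.re - 1| * a := mul_pos (abs_pos.2 (sub_ne_zero.2 hα)) ha
    have hre : ∀ ζ : ℂ, (lam * ζ).re = lam.re * ζ.re := fun ζ => by simp [hβ]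
    have hbound : ∀ ζ, ‖F ζ‖ ≤ (|lam.re| + 1) * K / (|lam.re - 1| * a) := by
      intro ζ
      rw [le_div_iff₀ hα']
      have h1 : |lam.re - 1| * a ≤ |lam.re| * |ζ.re - a| + |(lam * ζ).re - a| := by
        rw [hre, ← abs_mul, ← abs_of_pos ha, ← abs_mul, abs_of_pos ha]
        have : (lam.re - 1) * a = -(lam.re * (ζ.re - a)) + (lam.re * ζ.re - a) := by ring
        rw [this, ← abs_neg (lam.re * (ζ.re - a))]
        exact abs_add_le _ _
      calc ‖F ζ‖ * (|lam.re - 1| * a)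
          ≤ ‖F ζ‖ * (|lam.re| * |ζ.re - a| + |(lam * ζ).re - a|) := by gcongr
        _ = |lam.re| * (|ζ.re - a| * ‖F ζ‖) + |(lam * ζ).re - a| * ‖F ζ‖ := by ring
        _ ≤ |lam.re| * K + K := by gcongr; exacts [hb₁ ζ, hb₂ ζ]
        _ = _ := by ring
    have hdiff : Differentiable ℂ F := fun ζ => hd ζ <| by
      by_contra! h
      rw [hre, h.1] at h
      exact hα (mul_right_cancel₀ ha.ne' (h.2.trans (one_mul a).symm))
    have hconst := hdiff.apply_eq_apply_of_bounded
      ((isBounded_iff_forall_norm_le).2 ⟨_, by rintro _ ⟨ζ, rfl⟩; exact hbound ζ⟩)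
    have hK : 0 ≤ K := (by positivity : 0 ≤ |(0 : ℂ).re - a| * ‖F 0‖).trans (hb₁ 0)
    have hzero : F 0 = 0 := by
      by_contra h0
      have hn : 0 < ‖F 0‖ := norm_pos_iff.2 h0
      -- A point at distance `(K + 1) / ‖F 0‖` from the line, where the bound would read `K + 1 ≤
      -- K`.
      have h1 := hb₁ ((a + (K + 1) / ‖F 0‖ : ℝ) : ℂ)
      rw [hconst ((a + (K + 1) / ‖F 0‖ : ℝ) : ℂ) 0, Complex.ofReal_re, add_sub_cancel_left, abs_of_pos (by positivity),
        div_mul_cancel₀ _ hn.ne'] at h1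
      linarith
    exact ⟨1, 0, one_ne_zero, fun ζ _ => by rw [hconst ζ 0, hzero, smul_zero]⟩
  -- Nonreal `lam`: the lines are transversal, and `ω` is their crossing point.
  · obtain ⟨ω, hω₁, hω₂⟩ : ∃ ω : ℂ, ω.re = a ∧ (lam * ω).re = a := by
      refine ⟨⟨a, (lam.re - 1) * a / lam.im⟩, rfl, ?_⟩
      simp only [Complex.mul_re]
      field_simp
      ring
    have huniq : ∀ ζ : ℂ, ζ ≠ ω → ζ.re ≠ a ∨ (lam * ζ).re ≠ a := by
      intro ζ hζ
      by_contra! h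
      refine hζ (Complex.ext (h.1.trans hω₁.symm) ?_)
      have h2 := h.2.trans hω₂.symm
      simp only [Complex.mul_re, h.1, hω₁] at h2
      exact mul_left_cancel₀ hβ (by linarith)
    set G : ℂ → E := fun ζ => (ζ - ω) • F ζ with hG
    have hGd : ∀ ζ, ζ ≠ ω → DifferentiableAt ℂ G ζ := fun ζ hζ =>
      (differentiableAt_id.sub_const ω).smul (hd ζ (huniq ζ hζ))
    set M := K + (|lam.re| * K + K) / |lam.im| with hM
    have hGb : ∀ ζ, ‖G ζ‖ ≤ M := by
      intro ζ
      have hβ' : 0 < |lam.im| := abs_pos.2 hβ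
      -- By transversality, the distance to `ω` is at most a combination of the distances to the two
      -- lines; this makes `G` bounded.
      have h1 : ‖ζ - ω‖ ≤ |ζ.re - a| +
          (|lam.re| * |ζ.re - a| + |(lam * ζ).re - a|) / |lam.im| := by
        refine (Complex.norm_le_abs_re_add_abs_im _).trans ?_
        rw [Complex.sub_re, hω₁]
        gcongr
        rw [le_div_iff₀ hβ', ← abs_mul, ← abs_mul]
        have : (ζ - ω).im * lam.im = lam.re * (ζ.re - a) + -((lam * ζ).re - a) := by
          have h3 := hω₂
          simp only [Complex.mul_re, Complex.sub_im, hω₁] at h3 ⊢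
          linarith
        rw [this, ← abs_neg ((lam * ζ).re - a)]
        exact abs_add_le _ _
      calc ‖G ζ‖ = ‖ζ - ω‖ * ‖F ζ‖ := norm_smul _ _
        _ ≤ (|ζ.re - a| +
          (|lam.re| * |ζ.re - a| + |(lam * ζ).re - a|) / |lam.im|) * ‖F ζ‖ := by gcongr
        _ = |ζ.re - a| * ‖F ζ‖ + (|lam.re| * (|ζ.re - a| * ‖F ζ‖) +
            |(lam * ζ).re - a| * ‖F ζ‖) / |lam.im| := by ring
        _ ≤ M := by rw [hM]; gcongr; exacts [hb₁ ζ, hb₁ ζ, hb₂ ζ]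
    have hH := Complex.differentiableOn_update_limUnder_of_bddAbove (f := G) (s := univ) (c := ω)
      Filter.univ_mem (fun ζ hζ => (hGd ζ hζ.2).differentiableWithinAt)
      ⟨M, by rintro _ ⟨ζ, -, rfl⟩; exact hGb ζ⟩
    rw [differentiableOn_univ] at hH
    set L := Filter.limUnder (nhdsWithin ω {ω}ᶜ) G
    have hHb : Bornology.IsBounded (range (Function.update G ω L)) := by
      refine (isBounded_iff_forall_norm_le).2 ⟨max M ‖L‖, ?_⟩
      rintro _ ⟨ζ, rfl⟩
      by_cases hζ : ζ = ω
      · simp [hζ]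
      · rw [Function.update_of_ne hζ]
        exact (hGb ζ).trans (le_max_left _ _)
    refine ⟨ω, Function.update G ω L 0, fun h => ?_, fun ζ hζ => ?_⟩
    · rw [h, Complex.zero_re] at hω₁
      exact ha.ne hω₁
    · have hne : ζ ≠ ω := fun h => hζ (h ▸ hω₁)
      rw [← hH.apply_eq_apply_of_bounded hHb ζ 0, Function.update_of_ne hne]

/-- The inverse of `1 - ζ T` is `1 + ζ S`. This lets a concrete candidate `S` be recognised as `(1 -
ζ T)⁻¹ T`. -/
lemma isUnit_and_inverse_mul_eq {T S : E →L[ℂ] E} {ζ : ℂ}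
    (h : S * (1 - ζ • T) = T) (hc : T * S = S * T) :
    IsUnit (1 - ζ • T) ∧ Ring.inverse (1 - ζ • T) * T = S := by
  have h' : (1 - ζ • T) * S = T := by
    rw [sub_mul, smul_mul_assoc, hc, ← mul_smul_comm, one_mul]
    simpa [mul_sub] using h
  have hu : IsUnit (1 - ζ • T) :=
    ⟨⟨1 - ζ • T, 1 + ζ • S, by rw [mul_add, mul_smul_comm, h']; simp,
      by rw [add_mul, smul_mul_assoc, h]; simp⟩, rfl⟩
  refine ⟨hu, ?_⟩
  calc Ring.inverse (1 - ζ • T) * T = Ring.inverse (1 - ζ • T) * ((1 - ζ • T) * S) := by rw [h']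
    _ = S := by rw [← mul_assoc, Ring.inverse_mul_cancel _ hu, one_mul]

/-- Moving `X` to the left through `1 - ζ T` rescales `ζ` to `lam ζ`, and the same then holds for
the inverses. -/
lemma inverse_mul_intertwine {T X : E →L[ℂ] E} {lam ζ : ℂ} (hX : T * X = lam • (X * T))
    (h₁ : IsUnit (1 - ζ • T)) (h₂ : IsUnit (1 - (lam * ζ) • T)) :
    Ring.inverse (1 - ζ • T) * T * X = lam • (X * (Ring.inverse (1 - (lam * ζ) • T) * T)) := by
  have h : (1 - ζ • T) * X = X * (1 - (lam * ζ) • T) := by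
    rw [sub_mul, mul_sub, smul_mul_assoc, hX, mul_smul_comm, smul_smul, mul_comm lam]
    simp
  have h' : Ring.inverse (1 - ζ • T) * X = X * Ring.inverse (1 - (lam * ζ) • T) := by
    calc Ring.inverse (1 - ζ • T) * X
        = Ring.inverse (1 - ζ • T) * X * (1 - (lam * ζ) • T) *
            Ring.inverse (1 - (lam * ζ) • T) := by
          rw [mul_assoc _ (1 - (lam * ζ) • T), Ring.mul_inverse_cancel _ h₂, mul_one]
      _ = _ := by
          rw [mul_assoc _ X, ← h, ← mul_assoc, Ring.inverse_mul_cancel _ h₁, one_mul]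
  rw [mul_assoc, hX, mul_smul_comm, ← mul_assoc, h', mul_assoc]

/-- If `1 - ζ T` is injective for every `ζ`, and `(1 - ζ T)⁻¹ T` has norm at most
`1 / |Re ζ - a|`, then `T` has no extended eigenvalue other than `1`. -/
theorem eq_zero_of_intertwine [CompleteSpace E] {T X : E →L[ℂ] E} {a : ℝ} (ha : 0 < a)
    (hinj : ∀ y, T y = 0 → y = 0) (heig : ∀ (ζ : ℂ) (y : E), y = ζ • T y → y = 0)
    (hunit : ∀ ζ : ℂ, ζ.re ≠ a → IsUnit (1 - ζ • T))
    (hbound : ∀ ζ : ℂ, ζ.re ≠ a → |ζ.re - a| * ‖Ring.inverse (1 - ζ • T) * T‖ ≤ 1)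
    {lam : ℂ} (hlam : lam ≠ 1) (hX : T * X = lam • (X * T)) : X = 0 := by
  ext f
  set S : ℂ → E →L[ℂ] E := fun ζ => Ring.inverse (1 - ζ • T) * T with hS
  have hSd : ∀ ζ : ℂ, ζ.re ≠ a → DifferentiableAt ℂ S ζ := by
    intro ζ hζ
    have h1 : DifferentiableAt ℂ (fun ζ : ℂ => 1 - ζ • T) ζ := by fun_prop
    have h2 : DifferentiableAt ℂ Ring.inverse (1 - ζ • T) := differentiableAt_inverse (hunit ζ hζ)
    exact (h2.comp ζ h1).mul_const T
  have hbdd : ∀ (ζ : ℂ) (y : E), ζ.re ≠ a → |ζ.re - a| * ‖S ζ y‖ ≤ ‖y‖ := by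
    intro ζ y hζ
    calc |ζ.re - a| * ‖S ζ y‖ ≤ |ζ.re - a| * (‖S ζ‖ * ‖y‖) := by
          gcongr; exact (S ζ).le_opNorm y
      _ = |ζ.re - a| * ‖S ζ‖ * ‖y‖ := by ring
      _ ≤ 1 * ‖y‖ := by gcongr; exact hbound ζ hζ
      _ = ‖y‖ := one_mul _
  classical
  -- The two formulas agree where both resolvents exist. Where neither does, the value is
  -- immaterial: both weighted bounds carry a factor zero there.
  set F : ℂ → E := fun ζ => if ζ.re = a then lam • X (S (lam * ζ) f) else S ζ (X f) with hF
  have hF₁ : ∀ ζ : ℂ, ζ.re ≠ a → F ζ = S ζ (X f) := fun ζ hζ => if_neg hζ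
  have hF₂ : ∀ ζ : ℂ, (lam * ζ).re ≠ a → F ζ = lam • X (S (lam * ζ) f) := by
    intro ζ hζ
    by_cases h : ζ.re = a
    · exact if_pos h
    · rw [hF₁ ζ h]
      exact congrArg (fun Y : E →L[ℂ] E => Y f) (inverse_mul_intertwine hX (hunit ζ h) (hunit _ hζ))
  have hpole : ∃ (ω : ℂ) (P : E), ω ≠ 0 ∧ ∀ ζ : ℂ, ζ.re ≠ a → (ζ - ω) • F ζ = P := by
    refine exists_eq_simple_pole (F := F) (K := max ‖X f‖ (‖lam‖ * (‖X‖ * ‖f‖)))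
      ha hlam (fun ζ hζ => ?_) (fun ζ => ?_) (fun ζ => ?_)
    · rcases hζ with h | h
      · have hev : (fun z => S z (X f)) =ᶠ[nhds ζ] F := by
          filter_upwards [(isOpen_ne.preimage Complex.continuous_re).mem_nhds h] with z hz
          exact (hF₁ z hz).symm
        exact (((hSd ζ h).clm_apply (differentiableAt_const (X f)))).congr_of_eventuallyEq hev.symm
      · have hev : (fun z => lam • X (S (lam * z) f)) =ᶠ[nhds ζ] F := by
          have ho : IsOpen {z : ℂ | (lam * z).re ≠ a} :=
            isOpen_ne.preimage (Complex.continuous_re.comp (continuous_const_mul lam))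
          filter_upwards [ho.mem_nhds h] with z hz
          exact (hF₂ z hz).symm
        refine DifferentiableAt.congr_of_eventuallyEq ?_ hev.symm
        have h1 : DifferentiableAt ℂ (fun z => S (lam * z)) ζ :=
          (hSd _ h).comp ζ (by fun_prop : DifferentiableAt ℂ (fun z => lam * z) ζ)
        have h2 := h1.clm_apply (differentiableAt_const f)
        exact (X.differentiableAt.comp ζ h2).const_smul lam
    · by_cases h : ζ.re = a
      · rw [h]
        simp
      · rw [hF₁ ζ h]
        exact (hbdd ζ _ h).trans (le_max_left _ _)
    · by_cases h : (lam * ζ).re = a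
      · rw [h]
        simp
      · rw [hF₂ ζ h, norm_smul]
        refine le_trans ?_ (le_max_right _ _)
        calc |(lam * ζ).re - a| * (‖lam‖ * ‖X (S (lam * ζ) f)‖)
            ≤ |(lam * ζ).re - a| * (‖lam‖ * (‖X‖ * ‖S (lam * ζ) f‖)) := by
              gcongr; exact X.le_opNorm _
          _ = ‖lam‖ * (‖X‖ * (|(lam * ζ).re - a| * ‖S (lam * ζ) f‖)) := by ring
          _ ≤ _ := by gcongr; exact hbdd _ f h
  obtain ⟨ω, P, hω, hP⟩ := hpole
  have hP' : ∀ ζ : ℂ, ζ.re ≠ a → (1 - ζ • T) P = (ζ - ω) • T (X f) := by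
    intro ζ hζ
    rw [← hP ζ hζ, hF₁ ζ hζ, map_smul]
    congr 1
    change ((1 - ζ • T) * (Ring.inverse (1 - ζ • T) * T)) (X f) = _
    rw [← mul_assoc, Ring.mul_inverse_cancel _ (hunit ζ hζ), one_mul]
  -- Both `0` and `-1` lie to the left of the line since `a > 0`. Eliminating `T (X f)` between the
  -- two identities gives `T P = ω⁻¹ P`.
  have h0 := hP' 0 (by simpa using ha.ne)
  have h1 := hP' (-1) (by
    intro h
    simp only [Complex.neg_re, Complex.one_re] at h
    linarith)
  simp at h0 h1
  have hPz : P = 0 := by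
    refine heig ω P ?_
    have h2 : P + T P = ω⁻¹ • P + P := by
      rw [h1, h0]
      simp only [sub_smul, neg_smul, one_smul, smul_neg, smul_smul, inv_mul_cancel₀ hω]
      abel
    have h3 : T P = ω⁻¹ • P := by
      rw [add_comm] at h2
      exact add_right_cancel h2
    rw [h3, smul_smul, mul_inv_cancel₀ hω, one_smul]
  rw [hPz, eq_comm, neg_eq_zero, smul_eq_zero] at h0
  simpa using hinj _ (h0.resolve_left hω)

end Abstract

/-! ### Injectivity and absence of eigenvectors, through the primitive. -/

section Primitive

variable {p : ℝ≥0∞} [Fact (1 ≤ p)]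

lemma locallyIntegrable_indicator_Lp (f : Lp ℂ p halfLine) :
    LocallyIntegrable ((Ioi (0 : ℝ)).indicator f) volume := by
  rw [locallyIntegrable_iff]
  intro k hk
  obtain ⟨b, hb⟩ := hk.bddAbove
  rw [integrableOn_indicator_iff measurableSet_Ioi]
  have h := (intervalIntegrable_iff_integrableOn_Ioc_of_le (le_max_right b 1 |> zero_le_one.trans)).1
    (intervalIntegrable_of_Lp Fact.out f (x := max b 1) (by positivity))
  exact h.mono_set fun x hx => ⟨hx.1, (hb hx.2).trans (le_max_left _ _)⟩

/-- The primitive of an `L^p` function on the half-line. -/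
noncomputable def primitive (f : Lp ℂ p halfLine) (x : ℝ) : ℂ :=
  ∫ t in (0 : ℝ)..x, (Ioi (0 : ℝ)).indicator f t

lemma intervalIntegrable_indicator_Lp (f : Lp ℂ p halfLine) (a b : ℝ) :
    IntervalIntegrable ((Ioi (0 : ℝ)).indicator f) volume a b :=
  intervalIntegrable_iff.2 <| ((locallyIntegrable_indicator_Lp f).integrableOn_isCompact
    isCompact_uIcc).mono_set uIoc_subset_uIcc

lemma continuous_primitive_Lp (f : Lp ℂ p halfLine) : Continuous (primitive f) :=
  intervalIntegral.continuous_primitive (intervalIntegrable_indicator_Lp f) 0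

lemma ae_hasDerivAt_primitive (f : Lp ℂ p halfLine) :
    ∀ᵐ x ∂halfLine, HasDerivAt (primitive f) (f x) x := by
  filter_upwards [self_mem_ae_restrict measurableSet_Ioi,
    ae_restrict_of_ae
      (LocallyIntegrable.ae_hasDerivAt_integral (locallyIntegrable_indicator_Lp f))] with x hx h
  have h0 := h 0
  rwa [indicator_of_mem hx] at h0

lemma cesaroInfty_ae_eq_primitive (hp : 1 < p) (hp' : p < ∞) (f : Lp ℂ p halfLine) :
    cesaroInfty p hp hp' f =ᵐ[halfLine] fun x => (1 / (x : ℂ)) * primitive f x := by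
  filter_upwards [self_mem_ae_restrict measurableSet_Ioi, cesaroInfty_apply p hp hp' f] with x hx h
  have hx0 : (0 : ℝ) < x := hx
  rw [h, primitive, intervalIntegral.integral_of_le hx0.le, intervalIntegral.integral_of_le hx0.le]
  congr 1
  exact setIntegral_congr_fun measurableSet_Ioc fun t ht => (indicator_of_mem ht.1 _).symm

/-- A vanishing average forces the primitive to vanish almost everywhere, hence on all of `(0, ∞)`
by continuity; Lebesgue differentiation then recovers `f`. -/
lemma cesaroInfty_injective (hp : 1 < p) (hp' : p < ∞) (f : Lp ℂ p halfLine)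
    (h : cesaroInfty p hp hp' f = 0) : f = 0 := by
  have h1 : primitive f =ᵐ[halfLine] fun _ => 0 := by
    filter_upwards [self_mem_ae_restrict measurableSet_Ioi, cesaroInfty_ae_eq_primitive hp hp' f,
      Lp.coeFn_zero ℂ p halfLine] with x hx h2 h3
    have hx0 : (x : ℂ) ≠ 0 := Complex.ofReal_ne_zero.2 (ne_of_gt hx)
    rw [h, h3] at h2
    simpa [hx0] using h2.symm
  have h2 : EqOn (primitive f) (fun _ => 0) (Ioi 0) :=
    Measure.eqOn_open_of_ae_eq h1 isOpen_Ioi (continuous_primitive_Lp f).continuousOn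
      continuousOn_const
  refine (Lp.eq_zero_iff_ae_eq_zero).2 ?_
  filter_upwards [self_mem_ae_restrict measurableSet_Ioi, ae_hasDerivAt_primitive f] with x hx h3
  have h4 : HasDerivAt (primitive f) 0 x :=
    (hasDerivAt_const x (0 : ℂ)).congr_of_eventuallyEq (h2.eventuallyEq_of_mem (Ioi_mem_nhds hx))
  exact h3.unique h4

/-- The eigenvalue equation makes `f` almost everywhere equal to a function continuous on `(0, ∞)`,
so the derivative of the primitive exists at every point, not just almost every one. -/
lemma hasDerivAt_primitive_of_eigen (hp : 1 < p) (hp' : p < ∞) {ζ : ℂ} {f : Lp ℂ p halfLine}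
    (h : f = ζ • cesaroInfty p hp hp' f) :
    f =ᵐ[halfLine] (fun x => ζ * primitive f x / x) ∧
      ∀ x : ℝ, 0 < x → HasDerivAt (primitive f) (ζ * primitive f x / x) x := by
  have h1 : f =ᵐ[halfLine] fun x => ζ * primitive f x / x := by
    have h2 : f =ᵐ[halfLine] ζ • ⇑(cesaroInfty p hp hp' f) := by
      have := Lp.coeFn_smul ζ (cesaroInfty p hp hp' f)
      rwa [← h] at this
    filter_upwards [h2, cesaroInfty_ae_eq_primitive hp hp' f] with x h2 h3
    rw [h2, Pi.smul_apply, h3, smul_eq_mul]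
    ring
  refine ⟨h1, fun x hx => ?_⟩
  set g : ℝ → ℂ := fun x => ζ * primitive f x / x
  have hgc : ContinuousOn g (Ioi 0) := by
    refine ContinuousOn.div ?_ Complex.continuous_ofReal.continuousOn
      fun y hy => Complex.ofReal_ne_zero.2 (ne_of_gt hy)
    exact (continuous_const.mul (continuous_primitive_Lp f)).continuousOn
  have hsub : ∀ y : ℝ, 0 < y → uIcc 1 y ⊆ Ioi (0 : ℝ) := fun y hy t ht =>
    lt_of_lt_of_le (lt_min one_pos hy) ht.1
  -- Base point `1`, since `g` need not be continuous at `0`.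
  have h2 : ∀ y : ℝ, 0 < y → primitive f y = primitive f 1 + ∫ t in (1 : ℝ)..y, g t := by
    intro y hy
    rw [primitive, primitive, ← intervalIntegral.integral_add_adjacent_intervals
      (intervalIntegrable_indicator_Lp f 0 1) (intervalIntegrable_indicator_Lp f 1 y)]
    congr 1
    refine intervalIntegral.integral_congr_ae ?_
    have h3 := (ae_restrict_iff' measurableSet_Ioi).1 h1
    filter_upwards [h3] with t ht ht'
    have ht0 := hsub y hy (uIoc_subset_uIcc ht')
    rw [indicator_of_mem ht0, ht ht0]
  have h3 : HasDerivAt (fun y => primitive f 1 + ∫ t in (1 : ℝ)..y, g t) (g x) x :=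
    (intervalIntegral.integral_hasDerivAt_right
      ((hgc.mono (hsub x hx)).intervalIntegrable)
      (hgc.stronglyMeasurableAtFilter isOpen_Ioi x hx)
      (hgc.continuousAt (Ioi_mem_nhds hx))).const_add _
  exact h3.congr_of_eventuallyEq (Filter.eventuallyEq_of_mem (Ioi_mem_nhds hx) fun y hy => h2 y hy)

/-- The Cesàro operator has no eigenvectors. -/
lemma eq_zero_of_eq_smul_cesaroInfty (hp : 1 < p) (hp' : p < ∞) (ζ : ℂ) (f : Lp ℂ p halfLine)
    (h : f = ζ • cesaroInfty p hp hp' f) : f = 0 := by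
  obtain ⟨h1, h2⟩ := hasDerivAt_primitive_of_eigen hp hp' h
  by_cases hζ : ζ = 0
  · rw [h, hζ, zero_smul]
  -- Integrating factor for `x F' = ζ F`: the primitive is `c x^ζ`, so `f` is a multiple of `x^(ζ -
  -- 1)`.
  have hd : ∀ x : ℝ, 0 < x → HasDerivAt (fun x : ℝ => primitive f x * (x : ℂ) ^ (-ζ)) 0 x := by
    intro x hx
    have hx0 : (x : ℂ) ≠ 0 := Complex.ofReal_ne_zero.2 hx.ne'
    have h3 := (h2 x hx).mul (hasDerivAt_ofReal_cpow_const hx.ne' (neg_ne_zero.2 hζ))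
    refine h3.congr_deriv ?_
    rw [Complex.cpow_sub _ _ hx0, Complex.cpow_one]
    field_simp
    ring
  obtain ⟨c, hc⟩ := isOpen_Ioi.exists_is_const_of_deriv_eq_zero (convex_Ioi (0 : ℝ)).isPreconnected
    (fun x hx => (hd x hx).differentiableAt.differentiableWithinAt) (fun x hx => (hd x hx).deriv)
  have hf : ∀ᵐ x ∂halfLine, ‖f x‖ = ‖ζ * c‖ * x ^ (ζ.re - 1) := by
    filter_upwards [h1, self_mem_ae_restrict measurableSet_Ioi] with x h3 hx
    have hx' : (0 : ℝ) < x := hx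
    have hx0 : (x : ℂ) ≠ 0 := Complex.ofReal_ne_zero.2 hx'.ne'
    have h4 : ζ * primitive f x / x = ζ * c * (x : ℂ) ^ (ζ - 1) := by
      rw [← hc x hx, Complex.cpow_neg, Complex.cpow_sub _ _ hx0, Complex.cpow_one]
      have : (x : ℂ) ^ ζ ≠ 0 := by simp [Complex.cpow_eq_zero_iff, hx0]
      field_simp
    rw [h3, h4, norm_mul, Complex.norm_cpow_eq_rpow_re_of_pos hx']
    simp
  refine (Lp.eq_zero_iff_ae_eq_zero).2 ?_
  by_cases hcz : ζ * c = 0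
  · filter_upwards [hf] with x hx
    simpa [hcz] using hx
  -- No power of `x` is integrable on the whole half-line: it fails at `0` or at `∞`.
  · exfalso
    have hi := (Lp.memLp f).integrable_norm_rpow (zero_lt_one.trans hp).ne' hp'.ne
    refine not_integrableOn_Ioi_rpow ((ζ.re - 1) * p.toReal) ?_
    have hi2 := hi.const_mul ((‖ζ * c‖ ^ p.toReal)⁻¹)
    refine hi2.congr ?_
    filter_upwards [hf, self_mem_ae_restrict measurableSet_Ioi] with x h3 hx
    have hx' : (0 : ℝ) < x := hx
    have hn : (‖ζ * c‖ ^ p.toReal) ≠ 0 := (Real.rpow_pos_of_pos (norm_pos_iff.2 hcz) _).ne'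
    rw [h3, Real.mul_rpow (norm_nonneg _) (Real.rpow_nonneg hx'.le _), ← Real.rpow_mul hx'.le,
      ← mul_assoc, inv_mul_cancel₀ hn, one_mul]

end Primitive

/-! ### Bounded operators built from averages of dilations. -/

section Dilation

lemma ofReal_mul_lintegral_dilate {s : ℝ} (hs : 0 < s) {h : ℝ → ℝ≥0∞} (hh : Measurable h) :
    ENNReal.ofReal s * ∫⁻ x in Ioi 0, h (s * x) = ∫⁻ x in Ioi 0, h x := by
  have h1 : ∫⁻ x in Ioi 0, h (s * x) = ∫⁻ x, (Ioi (0 : ℝ)).indicator h (s * x) := by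
    rw [← lintegral_indicator measurableSet_Ioi]
    refine lintegral_congr fun x => ?_
    simp only [indicator, mem_Ioi, mul_pos_iff_of_pos_left hs]
  rw [h1, ← lintegral_map (hh.indicator measurableSet_Ioi) (measurable_const_mul s),
    ← lintegral_indicator measurableSet_Ioi, ← smul_eq_mul, ← lintegral_smul_measure]
  have h2 := Real.smul_map_volume_mul_left hs.ne'
  rw [abs_of_pos hs] at h2
  rw [h2]

/-- Minkowski's integral inequality for averages of dilations. -/
lemma lintegral_dilation_rpow_le {r q : ℝ} (h : r.HolderConjugate q) {φ g : ℝ → ℝ≥0∞}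
    (hφ : Measurable φ) (hg : Measurable g) :
    ∫⁻ x in Ioi 0, (∫⁻ s in Ioi 0, φ s * g (s * x)) ^ r ≤
      (∫⁻ s in Ioi 0, φ s * ENNReal.ofReal (s ^ (-(1 / r)))) ^ r * ∫⁻ x in Ioi 0, g x ^ r := by
  have hr := h.pos
  have hq := h.symm.pos
  have hinv : 1 / r + 1 / q = 1 := by simpa [one_div] using h.inv_add_inv_eq_one
  -- Hölder is applied to `φ(s) g(sx) = (w^(1/r) s^(1/r) g(sx)) · w^(1/q)`. After the `r`-th power
  -- the factor `s` cancels the Jacobian of `x ↦ s x`, so each `s` contributes `w s * I`.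
  set w : ℝ → ℝ≥0∞ := fun s => φ s * ENNReal.ofReal (s ^ (-(1 / r))) with hw
  have hwm : Measurable w := by fun_prop
  set N := ∫⁻ s in Ioi 0, w s
  set I := ∫⁻ x in Ioi 0, g x ^ r
  have hpt : ∀ x : ℝ, (∫⁻ s in Ioi 0, φ s * g (s * x)) ^ r ≤
      N ^ (r - 1) * ∫⁻ s in Ioi 0, w s * (ENNReal.ofReal s * g (s * x) ^ r) := by
    intro x
    have hold := ENNReal.lintegral_mul_le_Lp_mul_Lq (volume.restrict (Ioi 0)) h
      (f := fun s => w s ^ (1 / r) * (ENNReal.ofReal (s ^ (1 / r)) * g (s * x)))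
      (g := fun s => w s ^ (1 / q)) (by fun_prop) (by fun_prop)
    have e1 : ∫⁻ s in Ioi 0, ((fun s => w s ^ (1 / r) * (ENNReal.ofReal (s ^ (1 / r)) * g (s * x))) *
        (fun s => w s ^ (1 / q))) s = ∫⁻ s in Ioi 0, φ s * g (s * x) := by
      refine setLIntegral_congr_fun measurableSet_Ioi fun s hs => ?_
      have hs0 : (0 : ℝ) < s := hs
      simp only [Pi.mul_apply]
      rw [mul_right_comm, ← ENNReal.rpow_add_of_nonneg _ _ (by positivity) (by positivity), hinv,
        ENNReal.rpow_one, hw]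
      rw [mul_assoc, ← mul_assoc (ENNReal.ofReal _), ← ENNReal.ofReal_mul (by positivity),
        ← Real.rpow_add hs0, neg_add_cancel, Real.rpow_zero, ENNReal.ofReal_one, one_mul]
    have e2 : ∫⁻ s in Ioi 0, (w s ^ (1 / r) * (ENNReal.ofReal (s ^ (1 / r)) * g (s * x))) ^ r =
        ∫⁻ s in Ioi 0, w s * (ENNReal.ofReal s * g (s * x) ^ r) := by
      refine setLIntegral_congr_fun measurableSet_Ioi fun s hs => ?_
      have hs0 : (0 : ℝ) < s := hs
      rw [ENNReal.mul_rpow_of_nonneg _ _ hr.le, ENNReal.mul_rpow_of_nonneg _ _ hr.le,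
        ← ENNReal.rpow_mul, one_div_mul_cancel hr.ne', ENNReal.rpow_one,
        ENNReal.ofReal_rpow_of_pos (by positivity), ← Real.rpow_mul hs0.le,
        one_div_mul_cancel hr.ne', Real.rpow_one]
    have e3 : ∫⁻ s in Ioi 0, (w s ^ (1 / q)) ^ q = N := by
      simp only [← ENNReal.rpow_mul, one_div_mul_cancel hq.ne', ENNReal.rpow_one]
      rfl
    rw [e1, e2, e3] at hold
    refine (ENNReal.rpow_le_rpow hold hr.le).trans_eq ?_
    rw [ENNReal.mul_rpow_of_nonneg _ _ hr.le, ← ENNReal.rpow_mul, ← ENNReal.rpow_mul,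
      one_div_mul_cancel hr.ne', ENNReal.rpow_one, mul_comm]
    congr 2
    have : 1 / q = 1 - 1 / r := by linarith
    rw [this]
    field_simp
  calc ∫⁻ x in Ioi 0, (∫⁻ s in Ioi 0, φ s * g (s * x)) ^ r
      ≤ ∫⁻ x in Ioi 0, N ^ (r - 1) * ∫⁻ s in Ioi 0, w s * (ENNReal.ofReal s * g (s * x) ^ r) :=
        lintegral_mono hpt
    _ = N ^ (r - 1) * ∫⁻ x in Ioi 0, ∫⁻ s in Ioi 0, w s * (ENNReal.ofReal s * g (s * x) ^ r) := by
        refine lintegral_const_mul _ ?_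
        exact Measurable.lintegral_prod_right' (f := fun z : ℝ × ℝ =>
          w z.2 * (ENNReal.ofReal z.2 * g (z.2 * z.1) ^ r)) (by fun_prop)
    _ = N ^ (r - 1) * ∫⁻ s in Ioi 0, ∫⁻ x in Ioi 0, w s * (ENNReal.ofReal s * g (s * x) ^ r) := by
        congr 1
        refine lintegral_lintegral_swap (Measurable.aemeasurable ?_)
        simp only [Function.uncurry_def]
        fun_prop
    _ = N ^ (r - 1) * ∫⁻ s in Ioi 0, w s * I := by
        congr 1
        refine setLIntegral_congr_fun measurableSet_Ioi fun s hs => ?_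
        rw [lintegral_const_mul _ (by fun_prop), lintegral_const_mul _ (by fun_prop),
          ofReal_mul_lintegral_dilate hs (h := fun x => g x ^ r) (by fun_prop)]
    _ = N ^ (r - 1) * (N * I) := by rw [lintegral_mul_const _ hwm]
    _ = N ^ r * I := by
        have := h.lt
        rw [← mul_assoc]
        congr 1
        nth_rw 2 [← ENNReal.rpow_one N]
        rw [← ENNReal.rpow_add_of_nonneg _ _ (by linarith) zero_le_one, sub_add_cancel]

/-- The averages `x ↦ ∫₀^∞ φ(s) f(s x) ds` of the dilations of `f`. -/
noncomputable def dilationAvg (φ f : ℝ → ℂ) (x : ℝ) : ℂ := ∫ s in Ioi (0 : ℝ), φ s * f (s * x)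

/-- Multiplication by `x > 0` pulls null sets back to null sets, so averages of dilations depend
only on the class of `f`. -/
lemma ae_dilate {f g : ℝ → ℂ} (h : f =ᵐ[halfLine] g) {x : ℝ} (hx : 0 < x) :
    ∀ᵐ s ∂halfLine, f (s * x) = g (s * x) := by
  have hq : Measure.QuasiMeasurePreserving (fun s : ℝ => s * x) volume volume := by
    refine ⟨measurable_mul_const x, ?_⟩
    rw [Real.map_volume_mul_right hx.ne']
    exact Measure.smul_absolutelyContinuous
  have h1 := hq.ae ((ae_restrict_iff' measurableSet_Ioi).1 h)
  refine (ae_restrict_iff' measurableSet_Ioi).2 ?_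
  filter_upwards [h1] with s hs hs0
  exact hs (mul_pos hs0 hx)

lemma dilationAvg_congr (φ : ℝ → ℂ) {f g : ℝ → ℂ} (h : f =ᵐ[halfLine] g) {x : ℝ} (hx : 0 < x) :
    dilationAvg φ f x = dilationAvg φ g x := by
  refine integral_congr_ae ?_
  filter_upwards [ae_dilate h hx] with s hs
  rw [hs]

variable {p : ℝ≥0∞}

lemma lintegral_dilation_Lp_lt_top (hp : 1 < p) (hp' : p < ∞) {φ : ℝ → ℂ} {g : ℝ → ℝ≥0∞}
    (hφ : Measurable φ)
    (hN : ∫⁻ s in Ioi 0, ‖φ s‖ₑ * ENNReal.ofReal (s ^ (-(1 / p.toReal))) ≠ ∞)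
    (hg : Measurable g) (hgi : ∫⁻ x in Ioi 0, g x ^ p.toReal ≠ ∞) :
    ∫⁻ x in Ioi 0, (∫⁻ s in Ioi 0, ‖φ s‖ₑ * g (s * x)) ^ p.toReal < ∞ := by
  have h1 : 1 < p.toReal := by
    simpa using (ENNReal.toReal_lt_toReal ENNReal.one_ne_top hp'.ne).2 hp
  refine (lintegral_dilation_rpow_le (Real.HolderConjugate.conjExponent h1) hφ.enorm hg).trans_lt ?_
  exact ENNReal.mul_lt_top (ENNReal.rpow_lt_top_of_nonneg (by linarith) hN) hgi.lt_top

/-- Stated for general `g` because it serves both `|f|` and the Hardy average of `|f|`. -/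
lemma ae_lintegral_dilation_lt_top (hp : 1 < p) (hp' : p < ∞) {φ : ℝ → ℂ} {g : ℝ → ℝ≥0∞}
    (hφ : Measurable φ)
    (hN : ∫⁻ s in Ioi 0, ‖φ s‖ₑ * ENNReal.ofReal (s ^ (-(1 / p.toReal))) ≠ ∞)
    (hg : Measurable g) (hgi : ∫⁻ x in Ioi 0, g x ^ p.toReal ≠ ∞) :
    ∀ᵐ x ∂halfLine, ∫⁻ s in Ioi 0, ‖φ s‖ₑ * g (s * x) < ∞ := by
  have hm : Measurable fun x => ∫⁻ s in Ioi 0, ‖φ s‖ₑ * g (s * x) :=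
    Measurable.lintegral_prod_right' (f := fun z : ℝ × ℝ => ‖φ z.2‖ₑ * g (z.2 * z.1)) (by fun_prop)
  have h0 : 0 < p.toReal := ENNReal.toReal_pos (zero_lt_one.trans hp).ne' hp'.ne
  filter_upwards [ae_lt_top (hm.pow_const _)
    (lintegral_dilation_Lp_lt_top hp hp' hφ hN hg hgi).ne] with x hx
  exact (ENNReal.rpow_lt_top_iff_of_pos h0).1 hx

lemma lintegral_enorm_Lp_lt_top (hp : 1 < p) (hp' : p < ∞) (f : Lp ℂ p halfLine) :
    ∫⁻ x in Ioi 0, ‖f x‖ₑ ^ p.toReal < ∞ :=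
  lintegral_rpow_enorm_lt_top_of_eLpNorm_lt_top (zero_lt_one.trans hp).ne' hp'.ne
    (Lp.eLpNorm_lt_top f)

lemma ae_integrable_dilation (hp : 1 < p) (hp' : p < ∞) {φ : ℝ → ℂ} (hφ : Measurable φ)
    (hN : ∫⁻ s in Ioi 0, ‖φ s‖ₑ * ENNReal.ofReal (s ^ (-(1 / p.toReal))) ≠ ∞)
    (f : Lp ℂ p halfLine) :
    ∀ᵐ x ∂halfLine, Integrable (fun s => φ s * f (s * x)) halfLine := by
  have hf := (Lp.stronglyMeasurable f).measurable
  filter_upwards [ae_lintegral_dilation_lt_top hp hp' hφ hN hf.enorm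
    (lintegral_enorm_Lp_lt_top hp hp' f).ne] with x hx
  refine ⟨(by fun_prop : Measurable _).aestronglyMeasurable, ?_⟩
  simpa only [HasFiniteIntegral, enorm_mul] using hx

lemma eLpNorm_dilationAvg_le (hp : 1 < p) (hp' : p < ∞) {φ : ℝ → ℂ} (hφ : Measurable φ)
    (f : Lp ℂ p halfLine) :
    eLpNorm (dilationAvg φ f) p halfLine ≤
      (∫⁻ s in Ioi 0, ‖φ s‖ₑ * ENNReal.ofReal (s ^ (-(1 / p.toReal)))) *
        eLpNorm f p halfLine := by
  have hp0 : p ≠ 0 := (zero_lt_one.trans hp).ne'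
  have h1 : 1 < p.toReal := by
    simpa using (ENNReal.toReal_lt_toReal ENNReal.one_ne_top hp'.ne).2 hp
  have hr : 0 < p.toReal := by linarith
  have hf := (Lp.stronglyMeasurable f).measurable
  rw [eLpNorm_eq_lintegral_rpow_enorm_toReal hp0 hp'.ne,
    eLpNorm_eq_lintegral_rpow_enorm_toReal hp0 hp'.ne]
  set N := ∫⁻ s in Ioi 0, ‖φ s‖ₑ * ENNReal.ofReal (s ^ (-(1 / p.toReal)))
  calc _ ≤ (N ^ p.toReal * ∫⁻ x in Ioi 0, ‖f x‖ₑ ^ p.toReal) ^ (1 / p.toReal) := by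
        gcongr
        refine le_trans (lintegral_mono fun x => ?_)
          (lintegral_dilation_rpow_le (Real.HolderConjugate.conjExponent h1) hφ.enorm hf.enorm)
        gcongr
        refine (enorm_integral_le_lintegral_enorm _).trans_eq ?_
        simp only [enorm_mul]
    _ = _ := by
        rw [ENNReal.mul_rpow_of_nonneg _ _ (by positivity), ← ENNReal.rpow_mul,
          mul_one_div_cancel hr.ne', ENNReal.rpow_one]

lemma aestronglyMeasurable_dilationAvg {φ : ℝ → ℂ} (hφ : Measurable φ) (f : Lp ℂ p halfLine) :
    AEStronglyMeasurable (dilationAvg φ f) halfLine := by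
  have hf := (Lp.stronglyMeasurable f).measurable
  refine StronglyMeasurable.aestronglyMeasurable ?_
  exact StronglyMeasurable.integral_prod_right' (f := fun z : ℝ × ℝ => φ z.2 * f (z.2 * z.1))
    (by fun_prop : Measurable _).stronglyMeasurable

/-- Averages of dilations define bounded operators on `L^p`. -/
lemma exists_dilationOp [Fact (1 ≤ p)] (hp : 1 < p) (hp' : p < ∞) {φ : ℝ → ℂ} (hφ : Measurable φ)
    {K : ℝ} (hK : 0 ≤ K)
    (hN : ∫⁻ s in Ioi 0, ‖φ s‖ₑ * ENNReal.ofReal (s ^ (-(1 / p.toReal))) ≤ ENNReal.ofReal K) :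
    ∃ S : Lp ℂ p halfLine →L[ℂ] Lp ℂ p halfLine,
      (∀ f, S f =ᵐ[halfLine] dilationAvg φ f) ∧ ‖S‖ ≤ K := by
  have hN' := (hN.trans_lt ENNReal.ofReal_lt_top).ne
  have hle : ∀ f : Lp ℂ p halfLine, eLpNorm (dilationAvg φ f) p halfLine ≤
      ENNReal.ofReal K * eLpNorm f p halfLine := fun f =>
    (eLpNorm_dilationAvg_le hp hp' hφ f).trans (by gcongr)
  have hmem : ∀ f : Lp ℂ p halfLine, MemLp (dilationAvg φ f) p halfLine := fun f =>
    ⟨aestronglyMeasurable_dilationAvg hφ f,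
      (hle f).trans_lt (ENNReal.mul_lt_top ENNReal.ofReal_lt_top (Lp.eLpNorm_lt_top f))⟩
  refine ⟨LinearMap.mkContinuous
    { toFun := fun f => (hmem f).toLp (dilationAvg φ f)
      map_add' := fun f g => ?_
      map_smul' := fun c f => ?_ } K (fun f => ?_), fun f => MemLp.coeFn_toLp (hmem f),
    LinearMap.mkContinuous_norm_le _ hK _⟩
  · rw [← MemLp.toLp_add, MemLp.toLp_eq_toLp_iff]
    filter_upwards [self_mem_ae_restrict measurableSet_Ioi, ae_integrable_dilation hp hp' hφ hN' f,
      ae_integrable_dilation hp hp' hφ hN' g] with x hx hf hg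
    rw [dilationAvg_congr φ (Lp.coeFn_add f g) hx, Pi.add_apply, dilationAvg, dilationAvg,
      dilationAvg, ← integral_add hf hg]
    simp only [Pi.add_apply, mul_add]
  · rw [RingHom.id_apply, ← MemLp.toLp_const_smul, MemLp.toLp_eq_toLp_iff]
    filter_upwards [self_mem_ae_restrict measurableSet_Ioi] with x hx
    rw [dilationAvg_congr φ (Lp.coeFn_smul c f) hx, Pi.smul_apply, dilationAvg, dilationAvg,
      ← integral_smul]
    simp only [Pi.smul_apply, mul_smul_comm]
  · simp only [LinearMap.coe_mk, AddHom.coe_mk]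
    rw [Lp.norm_toLp, Lp.norm_def, ← ENNReal.toReal_ofReal hK, ← ENNReal.toReal_mul]
    exact ENNReal.toReal_mono
      (ENNReal.mul_lt_top ENNReal.ofReal_lt_top (Lp.eLpNorm_lt_top f)).ne (hle f)

end Dilation

/-! ### Composing the Cesàro operator with averages of dilations. -/

section Resolvent

variable {p : ℝ≥0∞}

lemma cesaroAvg_dilate (f : ℝ → ℂ) {s x : ℝ} (hs : 0 < s) :
    cesaroAvg f (s * x) = (1 / (x : ℂ)) * ∫ y in (0 : ℝ)..x, f (s * y) := by
  rw [intervalIntegral.integral_comp_mul_left f hs.ne', mul_zero, cesaroAvg]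
  rw [Complex.real_smul]
  push_cast
  have : (s : ℂ) ≠ 0 := Complex.ofReal_ne_zero.2 hs.ne'
  field_simp

lemma integrable_prod_dilation (hp : 1 < p) (hp' : p < ∞) {φ : ℝ → ℂ} (hφ : Measurable φ)
    (hN : ∫⁻ s in Ioi 0, ‖φ s‖ₑ * ENNReal.ofReal (s ^ (-(1 / p.toReal))) ≠ ∞)
    (f : Lp ℂ p halfLine) (x : ℝ) :
    Integrable (fun z : ℝ × ℝ => φ z.2 * f (z.2 * z.1))
      ((volume.restrict (Ioc 0 x)).prod halfLine) := by
  have hf := (Lp.stronglyMeasurable f).measurable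
  have hm : Measurable fun z : ℝ × ℝ => φ z.2 * f (z.2 * z.1) := by fun_prop
  refine ⟨hm.aestronglyMeasurable, ?_⟩
  have h1 : 1 < p.toReal := by
    simpa using (ENNReal.toReal_lt_toReal ENNReal.one_ne_top hp'.ne).2 hp
  set G : ℝ → ℝ≥0∞ := fun y => ∫⁻ s in Ioi 0, ‖φ s‖ₑ * ‖f (s * y)‖ₑ with hG
  -- On the bounded interval `(0, x]` this reduces integrability of `G` to that of its `p`-th power.
  have hle : ∀ t : ℝ≥0∞, t ≤ 1 + t ^ p.toReal := by
    intro t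
    rcases le_total t 1 with h | h
    · exact h.trans le_self_add
    · refine le_trans ?_ le_add_self
      simpa using ENNReal.rpow_le_rpow_of_exponent_le h h1.le
  calc ∫⁻ z, ‖φ z.2 * f (z.2 * z.1)‖ₑ ∂((volume.restrict (Ioc 0 x)).prod halfLine)
      = ∫⁻ y in Ioc 0 x, G y := by
        rw [lintegral_prod _ hm.enorm.aemeasurable]
        simp only [enorm_mul, hG]
    _ ≤ ∫⁻ y in Ioc 0 x, (1 + G y ^ p.toReal) := lintegral_mono fun y => hle _
    _ = volume (Ioc 0 x) + ∫⁻ y in Ioc 0 x, G y ^ p.toReal := by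
        rw [lintegral_add_left measurable_const, setLIntegral_one]
    _ < ∞ := by
        refine ENNReal.add_lt_top.2 ⟨by simp, ?_⟩
        refine lt_of_le_of_lt (lintegral_mono_set Ioc_subset_Ioi_self) ?_
        exact lintegral_dilation_Lp_lt_top hp hp' hφ hN hf.enorm
          (lintegral_enorm_Lp_lt_top hp hp' f).ne

/-- The Cesàro average commutes with each dilation; Fubini carries this over to averages of
dilations. -/
lemma cesaroAvg_dilationAvg (hp : 1 < p) (hp' : p < ∞) {φ : ℝ → ℂ} (hφ : Measurable φ)
    (hN : ∫⁻ s in Ioi 0, ‖φ s‖ₑ * ENNReal.ofReal (s ^ (-(1 / p.toReal))) ≠ ∞)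
    (f : Lp ℂ p halfLine) {x : ℝ} (hx : 0 < x) :
    cesaroAvg (dilationAvg φ f) x = dilationAvg φ (cesaroAvg f) x := by
  rw [cesaroAvg, intervalIntegral.integral_of_le hx.le]
  simp only [dilationAvg]
  rw [integral_integral_swap (integrable_prod_dilation hp hp' hφ hN f x), ← integral_const_mul]
  refine setIntegral_congr_fun measurableSet_Ioi fun s hs => ?_
  rw [cesaroAvg_dilate _ hs, intervalIntegral.integral_of_le hx.le, integral_const_mul]
  ring

/-- Averaging dilations of `C f` is averaging dilations of `f` with the kernel `∫_u^∞ φ(s)/s ds`. -/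
lemma dilationAvg_cesaroAvg (hp : 1 < p) (hp' : p < ∞) {φ : ℝ → ℂ} (hφ : Measurable φ)
    (hN : ∫⁻ s in Ioi 0, ‖φ s‖ₑ * ENNReal.ofReal (s ^ (-(1 / p.toReal))) ≠ ∞)
    (f : Lp ℂ p halfLine) :
    ∀ᵐ x ∂halfLine, dilationAvg φ (cesaroAvg f) x =
      ∫ u in Ioi (0 : ℝ), (∫ s in Ioi u, φ s / s) * f (u * x) := by
  have h1 : 1 < p.toReal := by
    simpa using (ENNReal.toReal_lt_toReal ENNReal.one_ne_top hp'.ne).2 hp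
  have hr : 0 < p.toReal := by linarith
  have hf := (Lp.stronglyMeasurable f).measurable
  -- The Hardy average of `|f|`. Finiteness of its own dilation average at `x` is the absolute
  -- convergence that Fubini needs below.
  set g : ℝ → ℝ≥0∞ := fun y => ENNReal.ofReal y⁻¹ * ∫⁻ t in Ioc 0 y, ‖f t‖ₑ with hg
  have hgm : Measurable g := by
    refine Measurable.mul (by fun_prop) ?_
    have hS : MeasurableSet {z : ℝ × ℝ | 0 < z.2 ∧ z.2 ≤ z.1} :=
      (measurableSet_lt measurable_const measurable_snd).inter
        (measurableSet_le measurable_snd measurable_fst)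
    have h2 : Measurable fun y : ℝ => ∫⁻ t, {z : ℝ × ℝ | 0 < z.2 ∧ z.2 ≤ z.1}.indicator
        (fun z => ‖f z.2‖ₑ) (y, t) :=
      Measurable.lintegral_prod_right' (Measurable.indicator (by fun_prop) hS)
    convert h2 using 2 with y
    rw [← lintegral_indicator measurableSet_Ioc]
    rfl
  have hgi : ∫⁻ x in Ioi 0, g x ^ p.toReal ≠ ∞ := by
    refine ((hardy_lintegral (Real.HolderConjugate.conjExponent h1) hf.enorm).trans_lt ?_).ne
    exact ENNReal.mul_lt_top (ENNReal.rpow_lt_top_of_nonneg hr.le ENNReal.ofReal_ne_top)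
      (lintegral_enorm_Lp_lt_top hp hp' f)
  filter_upwards [self_mem_ae_restrict measurableSet_Ioi,
    ae_lintegral_dilation_lt_top hp hp' hφ hN hgm hgi] with x hx hfin
  have hx0 : (0 : ℝ) < x := hx
  set D : Set (ℝ × ℝ) := {z | z.2 < z.1} with hD
  have hDm : MeasurableSet D := measurableSet_lt measurable_snd measurable_fst
  -- From `(C f)(s x) = (1/s) ∫₀ˢ f(u x) du`: integrating `Φ` first in `u` gives the left side,
  -- first in `s` the right side.
  set Φ : ℝ → ℝ → ℂ := fun s u => D.indicator (fun z => φ z.1 / z.1 * f (z.2 * x)) (s, u) with hΦ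
  have hΦm : Measurable (Function.uncurry Φ) := by
    have : Function.uncurry Φ = D.indicator (fun z => φ z.1 / z.1 * f (z.2 * x)) := by
      ext z
      rfl
    rw [this]
    exact Measurable.indicator (by fun_prop) hDm
  have hsec : ∀ s : ℝ, Φ s = (Iio s).indicator fun u => φ s / s * f (u * x) := by
    intro s
    ext u
    by_cases h : u < s <;> simp [hΦ, hD, indicator, h]
  have hsec' : ∀ u : ℝ, (fun s => Φ s u) = (Ioi u).indicator fun s => φ s / s * f (u * x) := by
    intro u
    ext s
    by_cases h : u < s <;> simp [hΦ, hD, indicator, h]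
  have hint : Integrable (Function.uncurry Φ) (halfLine.prod halfLine) := by
    refine ⟨hΦm.aestronglyMeasurable, ?_⟩
    refine lt_of_le_of_lt ?_ hfin
    rw [lintegral_prod _ hΦm.enorm.aemeasurable]
    refine setLIntegral_mono' measurableSet_Ioi fun s hs => ?_
    have hs0 : (0 : ℝ) < s := hs
    simp only [Function.uncurry_apply_pair, hsec, enorm_indicator_eq_indicator_enorm]
    rw [setLIntegral_indicator measurableSet_Iio]
    simp only [enorm_mul]
    rw [lintegral_const_mul _ (by fun_prop)]
    have h3 : ‖φ s / s‖ₑ = ‖φ s‖ₑ * ENNReal.ofReal s⁻¹ := by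
      rw [div_eq_mul_inv, enorm_mul]
      congr 1
      rw [← ofReal_norm, norm_inv, Complex.norm_real, Real.norm_of_nonneg hs0.le]
    rw [h3, mul_assoc]
    gcongr
    have h4 : ∫⁻ t in Ioc 0 (s * x), ‖f t‖ₑ =
        ENNReal.ofReal x * ∫⁻ u in Iio s ∩ Ioi 0, ‖f (u * x)‖ₑ := by
      have h5 := ofReal_mul_lintegral_dilate hx0
        (h := (Iio (s * x)).indicator fun t => ‖f t‖ₑ) (hf.enorm.indicator measurableSet_Iio)
      rw [setLIntegral_indicator measurableSet_Iio] at h5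
      have h6 : (Iio (s * x) ∩ Ioi 0 : Set ℝ) = Ioo 0 (s * x) := by
        ext t
        simp [and_comm]
      rw [setLIntegral_congr Ioo_ae_eq_Ioc.symm, ← h6, ← h5]
      congr 1
      rw [← setLIntegral_indicator measurableSet_Iio]
      refine lintegral_congr fun u => ?_
      by_cases h : u < s
      · simp [indicator, h, mul_comm x, hx0]
      · simp [indicator, h, mul_comm x, hx0]
    rw [hg]
    simp only
    rw [h4, ← mul_assoc, ← ENNReal.ofReal_mul (by positivity)]
    have h7 : (s * x)⁻¹ * x = s⁻¹ := by field_simp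
    rw [h7]
  have e1 : dilationAvg φ (cesaroAvg f) x = ∫ s in Ioi (0 : ℝ), ∫ u in Ioi (0 : ℝ), Φ s u := by
    refine setIntegral_congr_fun measurableSet_Ioi fun s hs => ?_
    have hs0 : (0 : ℝ) < s := hs
    simp only [hsec]
    rw [setIntegral_indicator measurableSet_Iio, Ioi_inter_Iio, integral_const_mul, mul_comm s x,
      cesaroAvg_dilate _ hx0, intervalIntegral.integral_of_le hs0.le, integral_Ioc_eq_integral_Ioo]
    simp only [mul_comm x]
    ring
  rw [e1, integral_integral_swap hint]
  refine setIntegral_congr_fun measurableSet_Ioi fun u hu => ?_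
  simp only [hsec']
  have hu0 : (0 : ℝ) < u := hu
  rw [setIntegral_indicator measurableSet_Ioi, integral_mul_const]
  congr 3
  exact (inter_eq_right.2 (Ioi_subset_Ioi hu0.le))

/-- The substitution `t = s x` exhibits the Cesàro operator itself as an average of dilations. -/
lemma dilationAvg_indicator_Iic (f : ℝ → ℂ) {x : ℝ} (hx : 0 < x) :
    dilationAvg ((Iic 1).indicator 1) f x = cesaroAvg f x := by
  have h1 : ∀ s, (Iic (1 : ℝ)).indicator (1 : ℝ → ℂ) s * f (s * x) =
      (Iic (1 : ℝ)).indicator (fun s => f (s * x)) s := by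
    intro s
    by_cases h : s ≤ 1 <;> simp [h]
  have h2 := cesaroAvg_dilate f hx (x := 1)
  rw [mul_one] at h2
  rw [h2, dilationAvg]
  simp only [h1]
  rw [setIntegral_indicator measurableSet_Iic, Ioi_inter_Iic,
    intervalIntegral.integral_of_le zero_le_one]
  simp [mul_comm x]

/-- A kernel `φ` with `ζ ∫_u^∞ φ(s)/s ds = φ(u) - 1_{u ≤ 1}` yields `(1 - ζ C)⁻¹ C`. -/
lemma exists_resolvent_of_kernel [Fact (1 ≤ p)] (hp : 1 < p) (hp' : p < ∞) {φ : ℝ → ℂ}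
    (hφ : Measurable φ) {K : ℝ} (hK : 0 ≤ K)
    (hN : ∫⁻ s in Ioi 0, ‖φ s‖ₑ * ENNReal.ofReal (s ^ (-(1 / p.toReal))) ≤ ENNReal.ofReal K)
    {ζ : ℂ}
    (hker : ∀ u : ℝ, 0 < u → ζ * ∫ s in Ioi u, φ s / s = φ u - (Iic 1).indicator 1 u) :
    ∃ S : Lp ℂ p halfLine →L[ℂ] Lp ℂ p halfLine,
      S * (1 - ζ • cesaroInfty p hp hp') = cesaroInfty p hp hp' ∧
      cesaroInfty p hp hp' * S = S * cesaroInfty p hp hp' ∧ ‖S‖ ≤ K := by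
  have hN' := (hN.trans_lt ENNReal.ofReal_lt_top).ne
  obtain ⟨S, hS, hSK⟩ := exists_dilationOp hp hp' hφ hK hN
  have hSC : ∀ f : Lp ℂ p halfLine,
      S (cesaroInfty p hp hp' f) =ᵐ[halfLine] dilationAvg φ (cesaroAvg f) := by
    intro f
    filter_upwards [self_mem_ae_restrict measurableSet_Ioi, hS (cesaroInfty p hp hp' f)] with x hx h
    rw [h]
    exact dilationAvg_congr φ (cesaroInfty_apply p hp hp' f) hx
  refine ⟨S, ?_, ?_, hSK⟩
  · ext1 f
    -- Comparison of kernels: `S C` has kernel `∫_u^∞ φ(s)/s ds`, and `hker` turns `ζ` times it into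
    -- the kernel of `S` minus that of `C`.
    have h1 : ζ • S (cesaroInfty p hp hp' f) = S f - cesaroInfty p hp hp' f := by
      refine Lp.ext ?_
      have hind : Measurable ((Iic (1 : ℝ)).indicator (1 : ℝ → ℂ)) :=
        measurable_one.indicator measurableSet_Iic
      filter_upwards [self_mem_ae_restrict measurableSet_Ioi, hSC f, hS f,
        Lp.coeFn_smul ζ (S (cesaroInfty p hp hp' f)), Lp.coeFn_sub (S f) (cesaroInfty p hp hp' f),
        cesaroInfty_apply p hp hp' f, dilationAvg_cesaroAvg hp hp' hφ hN' f,
        ae_integrable_dilation hp hp' hφ hN' f] with x hx a1 a2 a3 a4 a5 a6 a7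
      have hx0 : (0 : ℝ) < x := hx
      rw [a3, a4, Pi.smul_apply, Pi.sub_apply, a1, a2, a5, a6, smul_eq_mul, ← integral_const_mul]
      change _ = dilationAvg φ f x - cesaroAvg f x
      have a8 : Integrable (fun s => (Iic (1 : ℝ)).indicator (1 : ℝ → ℂ) s * f (s * x)) halfLine := by
        have a9 := (intervalIntegrable_of_Lp Fact.out f hx0).comp_mul_right (c := x)
        rw [zero_div, div_self hx0.ne', intervalIntegrable_iff_integrableOn_Ioc_of_le zero_le_one]
          at a9
        have b1 : (fun s => (Iic (1 : ℝ)).indicator (1 : ℝ → ℂ) s * f (s * x)) =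
            (Iic (1 : ℝ)).indicator (fun s => f (s * x)) := by
          ext s
          by_cases h : s ≤ 1 <;> simp [h]
        rw [b1, integrable_indicator_iff measurableSet_Iic, IntegrableOn,
          Measure.restrict_restrict measurableSet_Iic, inter_comm, Ioi_inter_Iic]
        exact a9
      rw [← dilationAvg_indicator_Iic f hx0, dilationAvg, dilationAvg, ← integral_sub a7 a8]
      refine setIntegral_congr_fun measurableSet_Ioi fun u hu => ?_
      rw [← mul_assoc, hker u hu, sub_mul]
    change S ((1 - ζ • cesaroInfty p hp hp') f) = _
    rw [sub_apply, map_sub, smul_apply, map_smul, h1,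
      one_apply_eq_self, sub_sub_cancel]
  · ext1 f
    refine Lp.ext ?_
    change cesaroInfty p hp hp' (S f) =ᵐ[halfLine] S (cesaroInfty p hp hp' f)
    filter_upwards [self_mem_ae_restrict measurableSet_Ioi, hSC f,
      cesaroInfty_apply p hp hp' (S f)] with x hx a1 a2
    rw [a1, a2]
    change cesaroAvg (S f) x = _
    rw [cesaroAvg_congr (hS f) hx, cesaroAvg_dilationAvg hp hp' hφ hN' f hx]

end Resolvent

/-! ### The two explicit resolvent kernels and their weighted integrals. -/

section Kernels

lemma cpow_neg_div_self {s : ℝ} (hs : 0 < s) (ζ : ℂ) : (s : ℂ) ^ (-ζ) / s = (s : ℂ) ^ (-ζ - 1) := by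
  rw [Complex.cpow_sub _ _ (Complex.ofReal_ne_zero.2 hs.ne'), Complex.cpow_one]

/-- For `u ≤ 1` and `ζ ≠ 0` the integral is `(u^(-ζ) - 1) / ζ`; for `u > 1`, or for `ζ = 0`, both
sides vanish. -/
lemma integral_Ioi_lower_kernel (ζ : ℂ) {u : ℝ} (hu : 0 < u) :
    ζ * ∫ s in Ioi u, (Iic (1 : ℝ)).indicator (fun s : ℝ => (s : ℂ) ^ (-ζ)) s / s =
      (Iic (1 : ℝ)).indicator (fun s : ℝ => (s : ℂ) ^ (-ζ)) u - (Iic 1).indicator 1 u := by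
  have h1 : ∫ s in Ioi u, (Iic (1 : ℝ)).indicator (fun s : ℝ => (s : ℂ) ^ (-ζ)) s / s =
      ∫ s in Ioc u 1, (s : ℂ) ^ (-ζ - 1) := by
    rw [← Ioi_inter_Iic, ← setIntegral_indicator measurableSet_Iic]
    refine setIntegral_congr_fun measurableSet_Ioi fun s hs => ?_
    by_cases h : s ≤ 1
    · simp [h, cpow_neg_div_self (hu.trans hs)]
    · simp [h]
  rw [h1]
  rcases le_or_gt u 1 with h | h
  · by_cases hζ : ζ = 0
    · simp [hζ, h]
    · rw [← intervalIntegral.integral_of_le h, integral_cpow (Or.inr ⟨?_, ?_⟩)]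
      · have : -ζ - 1 + 1 = -ζ := by ring
        rw [this]
        simp only [indicator_of_mem (mem_Iic.2 h), Complex.ofReal_one, Complex.one_cpow,
          Pi.one_apply]
        field_simp
        ring
      · intro h2
        exact hζ (by linear_combination -h2)
      · rw [uIcc_of_le h]
        exact fun h3 => hu.not_ge h3.1
  · simp [h.not_ge, Ioc_eq_empty_of_le h.le]

/-- The integral is `-max(u, 1)^(-ζ) / ζ`, and `Re ζ > 0` makes the tail converge. -/
lemma integral_Ioi_upper_kernel {ζ : ℂ} (hζ : 0 < ζ.re) {u : ℝ} (hu : 0 < u) :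
    ζ * ∫ s in Ioi u, (Ioi (1 : ℝ)).indicator (fun s : ℝ => -(s : ℂ) ^ (-ζ)) s / s =
      (Ioi (1 : ℝ)).indicator (fun s : ℝ => -(s : ℂ) ^ (-ζ)) u - (Iic 1).indicator 1 u := by
  have hζ0 : ζ ≠ 0 := fun h => by simp [h] at hζ
  have h1 : ∫ s in Ioi u, (Ioi (1 : ℝ)).indicator (fun s : ℝ => -(s : ℂ) ^ (-ζ)) s / s =
      -∫ s in Ioi (max u 1), (s : ℂ) ^ (-ζ - 1) := by
    rw [← integral_neg, ← Ioi_inter_Ioi, ← setIntegral_indicator measurableSet_Ioi]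
    refine setIntegral_congr_fun measurableSet_Ioi fun s hs => ?_
    by_cases h : 1 < s
    · simp [h, neg_div, cpow_neg_div_self (hu.trans hs)]
    · simp [h]
  rw [h1, integral_Ioi_cpow_of_lt (by
    rw [Complex.sub_re, Complex.neg_re, Complex.one_re]; linarith) (lt_max_of_lt_left hu)]
  have : -ζ - 1 + 1 = -ζ := by ring
  rw [this]
  rcases le_or_gt u 1 with h | h
  · simp [h, h.not_gt]
    field_simp
  · simp [h, h.not_ge, max_eq_left h.le]
    field_simp

lemma enorm_cpow_mul_ofReal_rpow {s : ℝ} (hs : 0 < s) (ζ : ℂ) (b : ℝ) :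
    ‖(s : ℂ) ^ (-ζ)‖ₑ * ENNReal.ofReal (s ^ b) = ENNReal.ofReal (s ^ (-ζ.re + b)) := by
  rw [← ofReal_norm, Complex.norm_cpow_eq_rpow_re_of_pos hs, ← ENNReal.ofReal_mul (by positivity),
    ← Real.rpow_add hs, Complex.neg_re]

lemma lintegral_lower_kernel {ζ : ℂ} {b : ℝ} (h : ζ.re < 1 - b) :
    ∫⁻ s in Ioi 0, ‖(Iic (1 : ℝ)).indicator (fun s : ℝ => (s : ℂ) ^ (-ζ)) s‖ₑ *
      ENNReal.ofReal (s ^ (-b)) = ENNReal.ofReal (1 - b - ζ.re)⁻¹ := by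
  have hlt : -1 < -ζ.re + -b := by linarith
  calc _ = ∫⁻ s in Ioc (0 : ℝ) 1, ENNReal.ofReal (s ^ (-ζ.re + -b)) := by
        rw [← Ioi_inter_Iic, inter_comm, ← setLIntegral_indicator measurableSet_Iic]
        refine setLIntegral_congr_fun measurableSet_Ioi fun s hs => ?_
        by_cases h : s ≤ 1
        · simp [h, enorm_cpow_mul_ofReal_rpow hs]
        · simp [h]
    _ = ENNReal.ofReal (1 - b - ζ.re)⁻¹ := by
        rw [← ofReal_integral_eq_lintegral_ofReal]
        · rw [← intervalIntegral.integral_of_le zero_le_one, integral_rpow (Or.inl hlt),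
            Real.one_rpow, Real.zero_rpow (by linarith), sub_zero, one_div]
          congr 2
          ring
        · exact (intervalIntegrable_iff_integrableOn_Ioc_of_le zero_le_one).1
            (intervalIntegral.intervalIntegrable_rpow' hlt)
        · filter_upwards [self_mem_ae_restrict measurableSet_Ioc] with t ht
          exact Real.rpow_nonneg ht.1.le _

lemma lintegral_upper_kernel {ζ : ℂ} {b : ℝ} (h : 1 - b < ζ.re) :
    ∫⁻ s in Ioi 0, ‖(Ioi (1 : ℝ)).indicator (fun s : ℝ => -(s : ℂ) ^ (-ζ)) s‖ₑ *
      ENNReal.ofReal (s ^ (-b)) = ENNReal.ofReal (ζ.re - (1 - b))⁻¹ := by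
  have hlt : -ζ.re + -b < -1 := by linarith
  calc _ = ∫⁻ s in Ioi (1 : ℝ), ENNReal.ofReal (s ^ (-ζ.re + -b)) := by
        rw [← inter_eq_left.2 (Ioi_subset_Ioi (zero_le_one' ℝ)),
          ← setLIntegral_indicator measurableSet_Ioi]
        refine setLIntegral_congr_fun measurableSet_Ioi fun s hs => ?_
        by_cases h : 1 < s
        · simp [h, enorm_cpow_mul_ofReal_rpow hs]
        · simp [h]
    _ = ENNReal.ofReal (ζ.re - (1 - b))⁻¹ := by
        rw [← ofReal_integral_eq_lintegral_ofReal (integrableOn_Ioi_rpow_of_lt hlt one_pos),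
          integral_Ioi_rpow_of_lt hlt one_pos, Real.one_rpow, neg_div, one_div, ← inv_neg]
        · congr 2
          ring
        · filter_upwards [self_mem_ae_restrict measurableSet_Ioi] with t ht
          exact Real.rpow_nonneg (zero_le_one.trans (le_of_lt ht)) _

end Kernels

/-! ### The resolvent estimate and the theorem. -/

/-- The resolvent of the Cesàro operator off its spectrum, with a norm bound. -/
lemma exists_resolvent_cesaroInfty {p : ℝ≥0∞} [Fact (1 ≤ p)] (hp : 1 < p) (hp' : p < ∞) {ζ : ℂ}
    (hζ : ζ.re ≠ 1 - 1 / p.toReal) :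
    ∃ S : Lp ℂ p halfLine →L[ℂ] Lp ℂ p halfLine,
      S * (1 - ζ • cesaroInfty p hp hp') = cesaroInfty p hp hp' ∧
      cesaroInfty p hp hp' * S = S * cesaroInfty p hp hp' ∧
      ‖S‖ ≤ |ζ.re - (1 - 1 / p.toReal)|⁻¹ := by
  have h1 : 1 < p.toReal := by
    simpa using (ENNReal.toReal_lt_toReal ENNReal.one_ne_top hp'.ne).2 hp
  rcases hζ.lt_or_gt with h | h
  · refine exists_resolvent_of_kernel hp hp'
      (φ := (Iic (1 : ℝ)).indicator (fun s : ℝ => (s : ℂ) ^ (-ζ)))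
      (Measurable.indicator (by fun_prop) measurableSet_Iic) (by positivity) ?_
      fun u hu => integral_Ioi_lower_kernel ζ hu
    rw [lintegral_lower_kernel h, abs_of_neg (sub_neg.2 h), neg_sub]
  -- Since `1 - 1/p > 0`, being right of the line implies `Re ζ > 0`, as the upper kernel requires.
  · have h2 : 1 / p.toReal < 1 := (div_lt_one (by linarith)).2 h1
    refine exists_resolvent_of_kernel hp hp'
      (φ := (Ioi (1 : ℝ)).indicator (fun s : ℝ => -(s : ℂ) ^ (-ζ)))
      (Measurable.indicator (by fun_prop) measurableSet_Ioi) (by positivity) ?_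
      fun u hu => integral_Ioi_upper_kernel (by linarith) hu
    rw [lintegral_upper_kernel h, abs_of_pos (sub_pos.2 h)]

lemma exists_Lp_halfLine_ne_zero (p : ℝ≥0∞) : ∃ f : Lp ℂ p halfLine, f ≠ 0 := by
  have hμ : halfLine (Ioc (0 : ℝ) 1) = 1 := by
    rw [Measure.restrict_apply measurableSet_Ioc, inter_eq_left.2 Ioc_subset_Ioi_self]
    simp
  refine ⟨indicatorConstLp p measurableSet_Ioc (by rw [hμ]; exact ENNReal.one_ne_top) (1 : ℂ),
    fun h => ?_⟩
  have h1 := (Lp.eq_zero_iff_ae_eq_zero).1 h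
  have h2 : ∀ᵐ x ∂halfLine, x ∉ Ioc (0 : ℝ) 1 := by
    filter_upwards [h1, indicatorConstLp_coeFn (p := p) (hs := measurableSet_Ioc)
      (hμs := by rw [hμ]; exact ENNReal.one_ne_top) (c := (1 : ℂ))] with x h3 h4 hx
    rw [h3, indicator_of_mem hx] at h4
    simp at h4
  rw [ae_iff] at h2
  simp only [not_not] at h2
  change halfLine (Ioc 0 1) = 0 at h2
  rw [hμ] at h2
  exact one_ne_zero h2

theorem mainTheorem5 (p : ℝ≥0∞) [Fact (1 ≤ p)] (hp : 1 < p) (hp' : p < ∞) :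
    (∀ lam : ℂ, lam ≠ 1 → ∀ X : Lp ℂ p halfLine →L[ℂ] Lp ℂ p halfLine,
      cesaroInfty p hp hp' ∘L X = lam • (X ∘L cesaroInfty p hp hp') → X = 0) ∧
    extendedEigenvalues (cesaroInfty p hp hp') = {1} := by
  have h1 : 1 < p.toReal := by
    simpa using (ENNReal.toReal_lt_toReal ENNReal.one_ne_top hp'.ne).2 hp
  have ha : 0 < 1 - 1 / p.toReal := sub_pos.2 ((div_lt_one (by linarith)).2 h1)
  have key : ∀ lam : ℂ, lam ≠ 1 → ∀ X : Lp ℂ p halfLine →L[ℂ] Lp ℂ p halfLine,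
      cesaroInfty p hp hp' ∘L X = lam • (X ∘L cesaroInfty p hp hp') → X = 0 := by
    intro lam hlam X hX
    refine eq_zero_of_intertwine ha (cesaroInfty_injective hp hp')
      (eq_zero_of_eq_smul_cesaroInfty hp hp') (fun ζ hζ => ?_) (fun ζ hζ => ?_) hlam hX
    · obtain ⟨S, hS, hc, -⟩ := exists_resolvent_cesaroInfty hp hp' hζ
      exact (isUnit_and_inverse_mul_eq hS hc).1
    · obtain ⟨S, hS, hc, hn⟩ := exists_resolvent_cesaroInfty hp hp' hζ
      rw [(isUnit_and_inverse_mul_eq hS hc).2]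
      have hpos : 0 < |ζ.re - (1 - 1 / p.toReal)| := abs_pos.2 (sub_ne_zero.2 hζ)
      calc _ ≤ |ζ.re - (1 - 1 / p.toReal)| * |ζ.re - (1 - 1 / p.toReal)|⁻¹ := by gcongr
        _ = 1 := mul_inv_cancel₀ hpos.ne'
  refine ⟨key, ?_⟩
  ext lam
  constructor
  · rintro ⟨X, hX0, hX⟩
    by_contra hlam
    exact hX0 (key lam hlam X hX)
  · rintro rfl
    obtain ⟨f, hf⟩ := exists_Lp_halfLine_ne_zero p
    -- The identity commutes with the operator, and it is nonzero because the space is nontrivial.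
    refine ⟨ContinuousLinearMap.id ℂ _, fun h => hf ?_, by simp⟩
    simpa using congrArg (fun Y : Lp ℂ p halfLine →L[ℂ] Lp ℂ p halfLine => Y f) h
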